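/- For a positive integer $n$ let $\zeta_n=\exp(2\pi i/n)$. A polynomial $\Delta(t)\in\mathbb{Z}[t]$ is called $n$-Hartley if there exist a polynomial $g(t)\in\mathbb{Z}[t]$ and a sign $\varepsilon\in\{1,-1\}$ such that $$\Delta(t^n)=\varepsilon\prod_{j=0}^{n-1} g(\zeta_n^{\,j}t).$$ A polynomial in $\mathbb{Z}[t]$ is primitive if no prime number divides all of its coefficients. Theorem. Let $m$ and $n$ be coprime positive integers, and let $\Delta(t)\in\mathbb{Z}[t]$ be a primitive polynomial. Then $\Delta(t)$ is $mn$-Hartley if and only if it is both $m$-Hartley and $n$-Hartley. -/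

import Mathlib

open Polynomial

/-- `IsHartley n Δ`: there are `g ∈ ℤ[t]` and a sign such that
`Δ(t ^ n) = ± ∏_{j = 0}^{n - 1} g(ζ ^ j t)` in `ℂ[t]`, where `ζ = exp (2 π i / n)`.
The notion is meant for positive `n`. -/
def IsHartley (n : ℕ) (Δ : ℤ[X]) : Prop :=
  ∃ g : ℤ[X],
    (Δ.map (Int.castRingHom ℂ)).comp (X ^ n) =
        ∏ j ∈ Finset.range n, (g.map (Int.castRingHom ℂ)).comp
          (C (Complex.exp (2 * Real.pi * Complex.I / n) ^ j) * X) ∨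
    (Δ.map (Int.castRingHom ℂ)).comp (X ^ n) =
        -∏ j ∈ Finset.range n, (g.map (Int.castRingHom ℂ)).comp
          (C (Complex.exp (2 * Real.pi * Complex.I / n) ^ j) * X)

/-! Both sides of the defining identity split over `ℂ`. Up to a constant, the identity says that the
root multiset of `Δ` is the multiset of `n`-th powers of the roots of some nonzero `g` in `ℚ[X]`;
primitivity forces the constant to be a sign (`isHartley_iff_exists_aroots_eq`).

For `a` in a field `K`, let `d_n(a)` be the least degree over `K` of an `n`-th root of `a`. It
divides `n` and the degree of every `n`-th root (`exists_isMinimalRoot`). Splitting `Δ` into prime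
powers over `ℚ` then shows that `g` exists iff, for every root `α` of `Δ`, `d_n(α)` taken over
`ℚ(α)` divides the multiplicity of `α` (`exists_aroots_eq_map_pow_iff`).

For coprime `m`, `n` the numbers `d_m` and `d_n` are coprime and `d_{mn} = d_m d_n`
(`IsMinimalRoot.natDegree_mul_eq`), so divisibility by `d_{mn}` is divisibility by both. -/

open IntermediateField

universe u

/-! ### Degrees of radicals. -/

section Degree

variable {K L : Type*} [Field K] [Field L] [Algebra K L]

theorem natDegree_minpoly_dvd_of_mem_adjoin {β γ : L} (hβ : IsIntegral K β) (h : γ ∈ K⟮β⟯) :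
    (minpoly K γ).natDegree ∣ (minpoly K β).natDegree := by
  have := adjoin.finiteDimensional hβ
  have := minpoly.degree_dvd (K := K) (x := (⟨γ, h⟩ : K⟮β⟯)) (Algebra.IsIntegral.isIntegral _)
  rwa [adjoin.finrank hβ, minpoly_eq] at this

theorem natDegree_minpoly_pow_dvd {β : L} (hβ : IsIntegral K β) (n : ℕ) :
    (minpoly K (β ^ n)).natDegree ∣ (minpoly K β).natDegree :=
  natDegree_minpoly_dvd_of_mem_adjoin hβ (pow_mem (mem_adjoin_simple_self K β) n)

theorem isIntegral_of_pow_eq_algebraMap {a : K} {β : L} {n : ℕ} (hn : 0 < n)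
    (h : β ^ n = algebraMap K L a) : IsIntegral K β :=
  IsIntegral.of_pow hn (h ▸ isIntegral_algebraMap)

theorem natDegree_minpoly_le_of_pow_eq {a : K} {β : L} {n : ℕ} (hn : 0 < n)
    (h : β ^ n = algebraMap K L a) : (minpoly K β).natDegree ≤ n := by
  have h1 : minpoly K β ∣ X ^ n - C a := minpoly.dvd _ _ (by simp [h])
  simpa using natDegree_le_of_dvd h1 (X_pow_sub_C_ne_zero hn a)

/-- Take norms from `K⟮β⟯` to `K` in `β ^ n = a`. -/
theorem exists_pow_eq_pow_natDegree_minpoly {a : K} {β : L} {n : ℕ} (hn : 0 < n)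
    (h : β ^ n = algebraMap K L a) : ∃ c : K, c ^ n = a ^ (minpoly K β).natDegree := by
  have hβ := isIntegral_of_pow_eq_algebraMap hn h
  refine ⟨Algebra.norm K (AdjoinSimple.gen K β), ?_⟩
  have : (AdjoinSimple.gen K β) ^ n = algebraMap K K⟮β⟯ a := by
    apply Subtype.ext
    simpa using h
  rw [← map_pow, this, Algebra.norm_algebraMap, adjoin.finrank hβ]

theorem natDegree_minpoly_adjoin_mul (α β : L) (hα : IsIntegral K α) (hβ : IsIntegral K β) :
    (minpoly K⟮α⟯ β).natDegree * (minpoly K α).natDegree =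
      Module.finrank K K⟮α, β⟯ := by
  rw [← adjoin.finrank hα, ← adjoin.finrank hβ.tower_top, mul_comm,
    Module.finrank_mul_finrank, ← adjoin_simple_adjoin_simple]
  rfl

theorem natDegree_minpoly_adjoin_pow_mul {β : L} (hβ : IsIntegral K β) (n : ℕ) :
    (minpoly K⟮β ^ n⟯ β).natDegree * (minpoly K (β ^ n)).natDegree =
      (minpoly K β).natDegree := by
  rw [natDegree_minpoly_adjoin_mul _ _ (hβ.pow n) hβ, ← adjoin.finrank hβ]
  have : K⟮β ^ n, β⟯ = K⟮β⟯ := by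
    refine le_antisymm (adjoin_le_iff.2 ?_) (adjoin.mono _ _ _ (by simp))
    rintro x (rfl | rfl)
    · exact pow_mem (mem_adjoin_simple_self K β) n
    · exact mem_adjoin_simple_self K _
  rw [this]

theorem natDegree_minpoly_le_mul {β γ δ : L} (hβ : IsIntegral K β) (hγ : IsIntegral K γ)
    (h : δ ∈ K⟮β, γ⟯) :
    (minpoly K δ).natDegree ≤ (minpoly K β).natDegree * (minpoly K γ).natDegree := by
  have hfin : FiniteDimensional K K⟮β, γ⟯ :=
    finiteDimensional_adjoin (by rintro x (rfl | rfl) <;> assumption)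
  have h1 := minpoly.natDegree_le (A := K) (⟨δ, h⟩ : K⟮β, γ⟯)
  rw [minpoly_eq, ← natDegree_minpoly_adjoin_mul β γ hβ hγ, mul_comm] at h1
  refine h1.trans (Nat.mul_le_mul_left _ ?_)
  have h2 := minpoly.dvd_map_of_isScalarTower K K⟮β⟯ γ
  have h3 := natDegree_le_of_dvd h2 (by simpa using minpoly.ne_zero hγ)
  simpa using h3

theorem natDegree_minpoly_of_pow_prime_eq {q : ℕ} (hq : q.Prime) {ζ : K}
    (hζ : IsPrimitiveRoot ζ q) {a : K} {β : L} (h : β ^ q = algebraMap K L a) :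
    (minpoly K β).natDegree = 1 ∨ (minpoly K β).natDegree = q := by
  by_cases hb : ∃ b : K, b ^ q = a
  · left
    obtain ⟨b, rfl⟩ := hb
    suffices ∃ c : K, β = algebraMap K L c by
      obtain ⟨c, rfl⟩ := this
      rw [minpoly.eq_X_sub_C, natDegree_X_sub_C]
    by_cases hb0 : b = 0
    · refine ⟨0, ?_⟩
      rw [hb0, zero_pow hq.ne_zero, map_zero] at h
      rw [map_zero, pow_eq_zero_iff hq.ne_zero |>.1 h]
    · have hb1 : algebraMap K L b ≠ 0 := by simpa using hb0
      have : NeZero q := ⟨hq.ne_zero⟩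
      obtain ⟨i, -, hi⟩ := (hζ.map_of_injective (algebraMap K L).injective).eq_pow_of_pow_eq_one
        (ξ := β / algebraMap K L b) (by
          rw [div_pow, h, map_pow, div_self (pow_ne_zero _ hb1)])
      refine ⟨ζ ^ i * b, ?_⟩
      rw [map_mul, map_pow, hi, div_mul_cancel₀ _ hb1]
  · right
    push Not at hb
    rw [← minpoly.eq_of_irreducible_of_monic (X_pow_sub_C_irreducible_of_prime hq hb)
      (by simp [h]) (monic_X_pow_sub_C a hq.ne_zero), natDegree_X_pow_sub_C]

end Degree

/-- Climb the tower `K ⊆ K⟮β ^ q ^ r⟯ ⊆ K⟮β⟯`: the lower step has degree `1` or `q`, the upper one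
is covered by induction. The base field changes to a subfield of `L`, hence the common universe. -/
theorem exists_natDegree_minpoly_eq_prime_pow {K L : Type u} [Field K] [Field L] [Algebra K L]
    {q : ℕ} (hq : q.Prime) {ζ : K} (hζ : IsPrimitiveRoot ζ q) (r : ℕ) {a : K} {β : L}
    (h : β ^ q ^ r = algebraMap K L a) : ∃ k, (minpoly K β).natDegree = q ^ k := by
  induction r generalizing K with
  | zero =>
    refine ⟨0, ?_⟩
    rw [pow_zero, pow_one] at h
    rw [h, minpoly.eq_X_sub_C, natDegree_X_sub_C, pow_zero]
  | succ r ih =>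
    have hβ := isIntegral_of_pow_eq_algebraMap (pow_pos hq.pos _) h
    obtain ⟨k, hk⟩ := ih (K := K⟮β ^ q ^ r⟯) (a := AdjoinSimple.gen K (β ^ q ^ r))
      (hζ.map_of_injective (algebraMap K K⟮β ^ q ^ r⟯).injective)
      (AdjoinSimple.algebraMap_gen K _).symm
    rw [← natDegree_minpoly_adjoin_pow_mul hβ (q ^ r), hk]
    rcases natDegree_minpoly_of_pow_prime_eq hq hζ (β := β ^ q ^ r) (a := a)
      (by rw [← pow_mul, ← pow_succ, h]) with h1 | h1
    · exact ⟨k, by rw [h1, mul_one]⟩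
    · exact ⟨k + 1, by rw [h1, pow_succ]⟩

/-! ### Minimal roots for prime power exponents. -/

/-- `β` is an `n`-th root of `a` whose degree over `K` divides `n` and the degree of every
`n`-th root of `a`. -/
structure IsMinimalRoot (K : Type*) {L : Type*} [Field K] [Field L] [Algebra K L] (n : ℕ) (a : K)
    (β : L) : Prop where
  pow_eq : β ^ n = algebraMap K L a
  dvd : (minpoly K β).natDegree ∣ n
  dvd_of_pow_eq : ∀ γ : L, γ ^ n = algebraMap K L a →
    (minpoly K β).natDegree ∣ (minpoly K γ).natDegree

theorem eq_of_pow_prime_pow_eq {K : Type*} [Field K] {q : ℕ} (hζ : ∀ z : K, z ^ q = 1 → z = 1)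
    {s : ℕ} {x y : K} (hy : y ≠ 0) (h : x ^ q ^ s = y ^ q ^ s) : x = y := by
  have key : ∀ s : ℕ, ∀ z : K, z ^ q ^ s = 1 → z = 1 := by
    intro s
    induction s with
    | zero => simp
    | succ s ih => exact fun z hz => ih z (hζ _ (by rwa [← pow_mul, ← pow_succ]))
  have := key s (x / y) (by rw [div_pow, h, div_self (pow_ne_zero _ hy)])
  rwa [div_eq_one_iff_eq hy] at this

theorem exists_pow_eq_of_pow_eq_pow {K : Type*} [Field K] {q : ℕ} (hq : q.Prime)
    (hζ : ∀ z : K, z ^ q = 1 → z = 1) {r s u : ℕ} (hsr : s ≤ r) (hu : q.Coprime u) {a c : K}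
    (ha : a ≠ 0) (h : c ^ q ^ r = a ^ (q ^ s * u)) : ∃ b : K, b ^ q ^ (r - s) = a := by
  obtain ⟨x, y, hxy⟩ : ∃ x y : ℕ, u * x = 1 + q ^ r * y := by
    have hcop : u.Coprime (q ^ r) := (hu.pow_left r).symm
    rcases Nat.eq_zero_or_pos r with rfl | hr
    · exact ⟨1, u - 1, by
        have : u ≠ 0 := by
          rintro rfl
          exact hq.one_lt.ne' (by simpa using hu)
        simp; omega⟩
    · obtain ⟨x, hx⟩ := Nat.exists_mul_mod_eq_one_of_coprime hcop
        (Nat.one_lt_pow hr.ne' hq.one_lt)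
      have := Nat.mod_add_div (u * x) (q ^ r)
      exact ⟨x, u * x / q ^ r, by omega⟩
  -- The witness `b` satisfies `b ^ q ^ r = a ^ (q ^ s * (u * x - q ^ r * y)) = a ^ q ^ s`, and `q ^
  -- s`-th powers can be cancelled.
  refine ⟨c ^ x / a ^ (q ^ s * y), eq_of_pow_prime_pow_eq (s := s) hζ ha ?_⟩
  rw [← pow_mul, ← pow_add, Nat.sub_add_cancel hsr, div_pow, ← pow_mul, mul_comm x, pow_mul, h,
    div_eq_iff (pow_ne_zero _ (pow_ne_zero _ ha)), ← pow_mul, ← pow_mul, ← pow_add]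
  congr 1
  rw [mul_assoc, hxy]
  ring

theorem exists_pow_dvd_natDegree_minpoly {K L : Type*} [Field K] [Field L] [Algebra K L]
    [IsAlgClosed L] (q : ℕ) {n : ℕ} (hn : 0 < n) (a : K) :
    ∃ β : L, β ^ n = algebraMap K L a ∧ ∀ γ : L, γ ^ n = algebraMap K L a →
      q ^ (minpoly K β).natDegree.factorization q ∣ (minpoly K γ).natDegree := by
  let f : L → ℕ := fun β => (minpoly K β).natDegree.factorization q
  let S : Set L := {β | β ^ n = algebraMap K L a}
  have hne : S.Nonempty :=
    IsAlgClosed.exists_pow_nat_eq _ hn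
  obtain ⟨β, hβ, hmin⟩ : ∃ β : L, β ^ n = algebraMap K L a ∧
      ∀ γ : L, γ ^ n = algebraMap K L a → f β ≤ f γ :=
    ⟨_, Function.argminOn_mem f S hne, fun γ hγ => Function.argminOn_le f S (a := γ) hγ⟩
  exact ⟨β, hβ, fun γ hγ => (pow_dvd_pow _ (hmin γ hγ)).trans (Nat.ordProj_dvd _ _)⟩

/-- The norm of `β` shows that `a` is a `q ^ (r - s)`-th power of some `b` in `K`. A `q ^ s`-th root
of `b` has degree at most `q ^ s`, which `hdvd` makes an equality. -/
theorem exists_natDegree_minpoly_eq_of_forall_dvd {K L : Type*} [Field K] [Field L] [Algebra K L]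
    [IsAlgClosed L] {q : ℕ} (hq : q.Prime) (hζ : ∀ z : K, z ^ q = 1 → z = 1) {r s u : ℕ} {a : K}
    (ha : a ≠ 0) {β : L} (hβ : β ^ q ^ r = algebraMap K L a)
    (hdeg : (minpoly K β).natDegree = q ^ s * u) (hu : q.Coprime u)
    (hdvd : ∀ γ : L, γ ^ q ^ r = algebraMap K L a → q ^ s ∣ (minpoly K γ).natDegree) :
    ∃ γ : L, γ ^ q ^ r = algebraMap K L a ∧ (minpoly K γ).natDegree = q ^ s := by
  have hqr : 0 < q ^ r := pow_pos hq.pos r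
  have hle : ∀ γ : L, γ ^ q ^ r = algebraMap K L a → q ^ s ≤ (minpoly K γ).natDegree :=
    fun γ hγ => Nat.le_of_dvd (minpoly.natDegree_pos (isIntegral_of_pow_eq_algebraMap hqr hγ))
      (hdvd γ hγ)
  have hsr : s ≤ r := (Nat.pow_le_pow_iff_right hq.one_lt).1
    ((hle β hβ).trans (natDegree_minpoly_le_of_pow_eq hqr hβ))
  obtain ⟨c, hc⟩ := exists_pow_eq_pow_natDegree_minpoly hqr hβ
  rw [hdeg] at hc
  obtain ⟨b, hb⟩ := exists_pow_eq_of_pow_eq_pow hq hζ hsr hu ha hc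
  obtain ⟨γ, hγ⟩ := IsAlgClosed.exists_pow_nat_eq (algebraMap K L b) (pow_pos hq.pos s)
  have hγ' : γ ^ q ^ r = algebraMap K L a := by
    rw [← hb, map_pow, ← hγ, ← pow_mul, ← pow_add, Nat.add_sub_cancel' hsr]
  exact ⟨γ, hγ', le_antisymm (natDegree_minpoly_le_of_pow_eq (pow_pos hq.pos s) hγ) (hle γ hγ')⟩

theorem exists_isMinimalRoot_prime_pow {K L : Type u} [Field K] [Field L] [Algebra K L]
    [IsAlgClosed L] {q : ℕ} (hq : q.Prime) (r : ℕ) {a : K} (ha : a ≠ 0) :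
    ∃ β : L, IsMinimalRoot K (q ^ r) a β := by
  have hqr : 0 < q ^ r := pow_pos hq.pos r
  suffices ∃ (β : L) (s : ℕ), β ^ q ^ r = algebraMap K L a ∧ (minpoly K β).natDegree = q ^ s ∧
      ∀ γ : L, γ ^ q ^ r = algebraMap K L a → q ^ s ∣ (minpoly K γ).natDegree by
    obtain ⟨β, s, h1, h2, h3⟩ := this
    refine ⟨β, h1, ?_, by rwa [h2]⟩
    rw [h2]
    refine pow_dvd_pow _ ((Nat.pow_le_pow_iff_right hq.one_lt).1 ?_)
    exact h2 ▸ natDegree_minpoly_le_of_pow_eq hqr h1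
  obtain ⟨β, hβ, hdvd⟩ := exists_pow_dvd_natDegree_minpoly (L := L) q hqr a
  have hpos : 0 < (minpoly K β).natDegree :=
    minpoly.natDegree_pos (isIntegral_of_pow_eq_algebraMap hqr hβ)
  -- Without nontrivial `q`-th roots of unity in `K`, the part of the degree prime to `q` can be
  -- removed; with them, every degree is already a power of `q`.
  by_cases hζ : ∀ z : K, z ^ q = 1 → z = 1
  · obtain ⟨γ, h1, h2⟩ := exists_natDegree_minpoly_eq_of_forall_dvd hq hζ ha hβ
      (Nat.ordProj_mul_ordCompl_eq_self _ q).symm (Nat.coprime_ordCompl hq hpos.ne') hdvd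
    exact ⟨γ, _, h1, h2, hdvd⟩
  · push Not at hζ
    obtain ⟨z, hz, hz1⟩ := hζ
    have hprim : IsPrimitiveRoot z q := by
      have : Fact q.Prime := ⟨hq⟩
      exact orderOf_eq_prime hz hz1 ▸ IsPrimitiveRoot.orderOf z
    obtain ⟨k, hk⟩ := exists_natDegree_minpoly_eq_prime_pow hq hprim r hβ
    have hk' : (minpoly K β).natDegree.factorization q = k := by
      rw [hk, hq.factorization_pow, Finsupp.single_eq_same]
    rw [hk'] at hdvd
    exact ⟨β, k, hβ, hk, hdvd⟩

/-! ### Coprime exponents. -/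

section Product

variable {K L : Type*} [Field K] [Field L] [Algebra K L] {m n : ℕ} {a : K}

/-- With `n * u + m * v = 1`, `(β ^ u * γ ^ v) ^ n = β ^ (n * u) * a ^ v = β`, and symmetrically for
`γ`. -/
theorem exists_pow_eq_and_pow_eq {a β γ : L} (hm : 0 < m) (hn : 0 < n) (hmn : m.Coprime n)
    (ha : a ≠ 0) (hβ : β ^ m = a)
    (hγ : γ ^ n = a) : ∃ u v : ℤ, (β ^ u * γ ^ v) ^ n = β ∧ (β ^ u * γ ^ v) ^ m = γ := by
  have hbez : (1 : ℤ) = m * m.gcdA n + n * m.gcdB n := by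
    rw [← Nat.gcd_eq_gcd_ab, hmn.gcd_eq_one, Nat.cast_one]
  have hβ0 : β ≠ 0 := by
    rintro rfl
    exact ha (by rw [← hβ, zero_pow hm.ne'])
  have hγ0 : γ ≠ 0 := by
    rintro rfl
    exact ha (by rw [← hγ, zero_pow hn.ne'])
  have hβ' : β ^ (m : ℤ) = a := by rw [zpow_natCast, hβ]
  have hγ' : γ ^ (n : ℤ) = a := by rw [zpow_natCast, hγ]
  refine ⟨m.gcdB n, m.gcdA n, ?_, ?_⟩
  · rw [← zpow_natCast, mul_zpow, ← zpow_mul, ← zpow_mul, mul_comm (m.gcdA n), zpow_mul γ, hγ',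
      ← hβ', ← zpow_mul, ← zpow_add₀ hβ0, mul_comm _ (n : ℤ), add_comm, ← hbez, zpow_one]
  · rw [← zpow_natCast, mul_zpow, ← zpow_mul, ← zpow_mul, mul_comm (m.gcdB n), zpow_mul β, hβ',
      ← hγ', ← zpow_mul, ← zpow_add₀ hγ0, mul_comm _ (m : ℤ), add_comm, ← hbez, zpow_one]

/-- If `x ^ (m * n) = a`, then `x ^ n` and `x ^ m` are roots of exponents `m` and `n`, so both
coprime degrees divide that of `x`. The root `δ` lies in `K⟮β, γ⟯`, which bounds its degree from
above. -/
theorem IsMinimalRoot.exists_mul (hm : 0 < m) (hn : 0 < n) (hmn : m.Coprime n) (ha : a ≠ 0)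
    {β γ : L} (hβ : IsMinimalRoot K m a β) (hγ : IsMinimalRoot K n a γ) :
    ∃ δ : L, IsMinimalRoot K (m * n) a δ ∧
      (minpoly K δ).natDegree = (minpoly K β).natDegree * (minpoly K γ).natDegree := by
  obtain ⟨u, v, h1, h2⟩ := exists_pow_eq_and_pow_eq hm hn hmn (by simpa using ha) hβ.pow_eq hγ.pow_eq
  set δ := β ^ u * γ ^ v
  have hδ : δ ^ (m * n) = algebraMap K L a := by rw [mul_comm, pow_mul, h1, hβ.pow_eq]
  have hcop := Nat.Coprime.coprime_dvd_left hβ.dvd (hmn.coprime_dvd_right hγ.dvd)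
  have hdvd : ∀ x : L, x ^ (m * n) = algebraMap K L a →
      (minpoly K β).natDegree * (minpoly K γ).natDegree ∣ (minpoly K x).natDegree := by
    intro x hx
    have hxi := isIntegral_of_pow_eq_algebraMap (Nat.mul_pos hm hn) hx
    exact hcop.mul_dvd_of_dvd_of_dvd
      ((hβ.dvd_of_pow_eq (x ^ n) (by rw [← pow_mul, mul_comm, hx])).trans
        (natDegree_minpoly_pow_dvd hxi n))
      ((hγ.dvd_of_pow_eq (x ^ m) (by rw [← pow_mul, hx])).trans (natDegree_minpoly_pow_dvd hxi m))
  have hdeg : (minpoly K δ).natDegree = (minpoly K β).natDegree * (minpoly K γ).natDegree := by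
    refine le_antisymm (natDegree_minpoly_le_mul (isIntegral_of_pow_eq_algebraMap hm hβ.pow_eq)
      (isIntegral_of_pow_eq_algebraMap hn hγ.pow_eq) ?_) (Nat.le_of_dvd
        (minpoly.natDegree_pos (isIntegral_of_pow_eq_algebraMap (Nat.mul_pos hm hn) hδ))
        (hdvd δ hδ))
    exact mul_mem (zpow_mem (subset_adjoin _ _ (by simp)) u)
      (zpow_mem (subset_adjoin _ _ (by simp)) v)
  exact ⟨δ, ⟨hδ, hdeg ▸ mul_dvd_mul hβ.dvd hγ.dvd, hdeg ▸ hdvd⟩, hdeg⟩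

theorem isMinimalRoot_zero (hn : 0 < n) : IsMinimalRoot K n 0 (0 : L) := by
  exact ⟨by simp [hn.ne'], by simp, by simp⟩

end Product

theorem exists_isMinimalRoot {K : Type u} (L : Type u) [Field K] [Field L] [Algebra K L]
    [IsAlgClosed L] {n : ℕ} (hn : 0 < n) (a : K) : ∃ β : L, IsMinimalRoot K n a β := by
  rcases eq_or_ne a 0 with rfl | ha
  · exact ⟨0, isMinimalRoot_zero hn⟩
  induction n using Nat.recOnPosPrimePosCoprime with
  | prime_pow q r hq _ => exact exists_isMinimalRoot_prime_pow hq r ha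
  | zero => exact absurd hn (lt_irrefl 0)
  | one => exact ⟨algebraMap K L a, by simp, by simp [minpoly.eq_X_sub_C], by
      simp [minpoly.eq_X_sub_C]⟩
  | coprime m k hm hk hmk ihm ihk =>
    obtain ⟨β, hβ⟩ := ihm (by omega)
    obtain ⟨γ, hγ⟩ := ihk (by omega)
    obtain ⟨δ, hδ, -⟩ := hβ.exists_mul (by omega) (by omega) hmk ha hγ
    exact ⟨δ, hδ⟩

theorem IsMinimalRoot.natDegree_mul_eq {K : Type u} {L : Type u} [Field K] [Field L] [Algebra K L]
    [IsAlgClosed L] {m n : ℕ} (hm : 0 < m) (hn : 0 < n) (hmn : m.Coprime n) {a : K} {β γ δ : L}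
    (hβ : IsMinimalRoot K m a β) (hγ : IsMinimalRoot K n a γ) (hδ : IsMinimalRoot K (m * n) a δ) :
    (minpoly K δ).natDegree = (minpoly K β).natDegree * (minpoly K γ).natDegree := by
  rcases eq_or_ne a 0 with rfl | ha
  · have h0 : ∀ {k : ℕ} {x : L}, IsMinimalRoot K k 0 x → 0 < k → x = 0 := fun h hk => by
      simpa [hk.ne'] using h.pow_eq
    rw [h0 hβ hm, h0 hγ hn, h0 hδ (Nat.mul_pos hm hn)]
    simp
  · obtain ⟨x, hx, h⟩ := hβ.exists_mul hm hn hmn ha hγ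
    rw [← h]
    exact Nat.dvd_antisymm (hδ.dvd_of_pow_eq _ hx.pow_eq) (hx.dvd_of_pow_eq _ hδ.pow_eq)

/-! ### Necessity: counting roots above `a`. -/

section Count

variable {K L : Type*} [Field K] [Field L] [Algebra K L]

theorem aroots_eq_aroots_minpoly {p : K[X]} (hp : Irreducible p) {γ : L} (hγ : aeval γ p = 0) :
    p.aroots L = (minpoly K γ).aroots L := by
  rw [← minpoly.eq_of_irreducible hp hγ, mul_comm, aroots_C_mul]
  simpa using hp.ne_zero

theorem aroots_of_isUnit {p : K[X]} (hp : IsUnit p) : p.aroots L = 0 := by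
  obtain ⟨c, -, rfl⟩ := isUnit_iff.1 hp
  simp

/-- The number of roots `x` of `g` with `x ^ n = a` is divisible by the minimal degree of an
`n`-th root of `a`. -/
theorem IsMinimalRoot.dvd_count_map_aroots [IsAlgClosed L] [DecidableEq L] {n : ℕ} {a : K}
    {β : L} (hβ : IsMinimalRoot K n a β) {g : K[X]} (hg : g ≠ 0) :
    (minpoly K β).natDegree ∣ ((g.aroots L).map (· ^ n)).count (algebraMap K L a) := by
  induction g using UniqueFactorizationMonoid.induction_on_prime with
  | h₁ => exact absurd rfl hg
  | h₂ x hx => simp [aroots_of_isUnit hx]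
  | h₃ g p hg0 hp ih =>
    rw [aroots_mul (mul_ne_zero hp.ne_zero hg0), Multiset.map_add, Multiset.count_add]
    refine dvd_add ?_ (ih hg0)
    -- If one root of the irreducible `p` is an `n`-th root of `a`, then all are, as `minpoly K γ`
    -- divides `X ^ n - C a`; so `p` contributes its full degree or nothing.
    by_cases h : ∃ γ ∈ p.aroots L, γ ^ n = algebraMap K L a
    · obtain ⟨γ, hγ, hγn⟩ := h
      rw [aroots_eq_aroots_minpoly hp.irreducible ((mem_aroots.1 hγ).2)]
      have : ((minpoly K γ).aroots L).map (· ^ n) =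
          Multiset.replicate ((minpoly K γ).aroots L).card (algebraMap K L a) := by
        refine Multiset.eq_replicate.2 ⟨Multiset.card_map _ _, fun x hx => ?_⟩
        obtain ⟨y, hy, rfl⟩ := Multiset.mem_map.1 hx
        have h1 : minpoly K γ ∣ X ^ n - C a := minpoly.dvd _ _ (by simp [hγn])
        have h2 := aeval_eq_zero_of_dvd_aeval_eq_zero h1 (mem_aroots.1 hy).2
        simpa [sub_eq_zero] using h2
      rw [this, Multiset.count_replicate_self, IsAlgClosed.card_aroots_eq_natDegree]
      exact hβ.dvd_of_pow_eq γ hγn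
    · rw [Multiset.count_eq_zero_of_notMem]
      · exact dvd_zero _
      · rintro hx
        obtain ⟨y, hy, hyn⟩ := Multiset.mem_map.1 hx
        exact h ⟨y, hy, hyn⟩

end Count

/-! ### Conjugates and embeddings. -/

section Embeddings

variable {K F : Type*} (E : Type*) [Field K] [Field F] [Field E] [Algebra K F] [Algebra K E]
  [IsAlgClosed E] [FiniteDimensional K F] [Algebra.IsSeparable K F]

/-- Each embedding of `K⟮x⟯` extends to `F` in `[F : K⟮x⟯]` ways, and embeddings of `K⟮x⟯`
correspond to the conjugates of `x`. -/
theorem sum_embeddings_singleton_eq (x : F) :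
    ∑ σ : F →ₐ[K] E, ({σ x} : Multiset E) =
      Module.finrank K⟮x⟯ F • (minpoly K x).aroots E := by
  classical
  have hx := Algebra.IsSeparable.isIntegral K x
  let pb := adjoin.powerBasis hx
  have hsep : Algebra.IsSeparable K K⟮x⟯ := Algebra.isSeparable_tower_bot_of_isSeparable K K⟮x⟯ F
  have hsep' : Algebra.IsSeparable K⟮x⟯ F := Algebra.isSeparable_tower_top_of_isSeparable K K⟮x⟯ F
  let : Fintype (K⟮x⟯ →ₐ[K] E) := PowerBasis.AlgHom.fintype pb
  have h1 : ∑ σ : F →ₐ[K] E, ({σ x} : Multiset E) =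
      Module.finrank K⟮x⟯ F • ∑ σ : K⟮x⟯ →ₐ[K] E, ({σ pb.gen} : Multiset E) := by
    rw [Fintype.sum_equiv algHomEquivSigma (fun σ : F →ₐ[K] E => ({σ x} : Multiset E))
      (fun σ => {σ.1 pb.gen}), ← Finset.univ_sigma_univ, Finset.sum_sigma, Finset.smul_sum]
    · refine Finset.sum_congr rfl fun σ _ => ?_
      let : Algebra K⟮x⟯ E := σ.toRingHom.toAlgebra
      simp_rw [Finset.sum_const]
      congr
      exact AlgHom.card K⟮x⟯ F E
    · intro σ
      simp only [algHomEquivSigma, Equiv.coe_fn_mk, AlgHom.domRestrict, AlgHom.comp_apply,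
        IsScalarTower.coe_toAlgHom', pb, adjoin.powerBasis_gen, AdjoinSimple.algebraMap_gen]
  have h2 : ∑ σ : K⟮x⟯ →ₐ[K] E, ({σ pb.gen} : Multiset E) = (minpoly K x).aroots E := by
    have hmin : minpoly K pb.gen = minpoly K x := by
      rw [adjoin.powerBasis_gen, minpoly_gen]
    rw [Fintype.sum_equiv pb.liftEquiv' (fun σ => ({σ pb.gen} : Multiset E)) (fun y => {y.1})
      (fun σ => by rw [PowerBasis.liftEquiv'_apply_coe]), hmin]
    rw [Finset.sum_mem_multiset _ _ (fun y => ({y} : Multiset E)) (by intros; rfl)]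
    rw [Finset.sum_eq_multiset_sum, Multiset.toFinset_val, Multiset.dedup_eq_self.mpr,
      Multiset.sum_map_singleton]
    exact nodup_roots (Separable.map (Algebra.IsSeparable.isSeparable K x))
  rw [h1, h2]

end Embeddings

/-! ### Sufficiency: constructing `g` from minimal roots. -/

section Norm

variable {K L : Type*} [Field K] [CharZero K] [Field L] [Algebra K L] [IsAlgClosed L]

/-- Both sides list `σ β ^ n` over the embeddings `σ` of `K⟮β⟯`. -/
theorem map_pow_aroots_minpoly {β : L} (hβ : IsIntegral K β) (n : ℕ) :
    ((minpoly K β).aroots L).map (· ^ n) =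
      (minpoly K⟮β ^ n⟯ β).natDegree • (minpoly K (β ^ n)).aroots L := by
  have := adjoin.finiteDimensional hβ
  have key : ∀ x : K⟮β⟯, ∃ k, k * (minpoly K (x : L)).natDegree = (minpoly K β).natDegree ∧
      ∑ σ : K⟮β⟯ →ₐ[K] L, ({σ x} : Multiset L) = k • (minpoly K (x : L)).aroots L := by
    intro x
    refine ⟨_, ?_, by rw [sum_embeddings_singleton_eq, minpoly_eq]⟩
    rw [← adjoin.finrank hβ, ← minpoly_eq, ← adjoin.finrank (Algebra.IsIntegral.isIntegral x),
      mul_comm, Module.finrank_mul_finrank]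
  obtain ⟨k, hk, h1⟩ := key (AdjoinSimple.gen K β)
  obtain ⟨l, hl, h2⟩ := key (AdjoinSimple.gen K β ^ n)
  have hk1 : k = 1 := by
    rw [AdjoinSimple.coe_gen] at hk
    exact Nat.eq_of_mul_eq_mul_right (minpoly.natDegree_pos hβ) (by rw [hk, one_mul])
  rw [hk1, one_smul, AdjoinSimple.coe_gen] at h1
  have hcoe : ((AdjoinSimple.gen K β ^ n : K⟮β⟯) : L) = β ^ n := by simp
  rw [hcoe] at hl h2
  have hl' : l = (minpoly K⟮β ^ n⟯ β).natDegree :=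
    Nat.eq_of_mul_eq_mul_right (minpoly.natDegree_pos (hβ.pow n))
      (by rw [hl, natDegree_minpoly_adjoin_pow_mul hβ])
  rw [← hl', ← h2, ← h1, ← Multiset.coe_mapAddMonoidHom, map_sum]
  simp

/-- A polynomial whose root multiplicities are divisible by the minimal degrees of the `n`-th
roots of its roots is, up to a constant, obtained by raising the roots of another polynomial to
the `n`-th power. -/
theorem exists_aroots_eq_map_pow [DecidableEq L] {n : ℕ} (hn : 0 < n) {D : K[X]} (hD : D ≠ 0)
    (h : ∀ α ∈ D.aroots L, ∃ β : L, IsMinimalRoot K⟮α⟯ n (AdjoinSimple.gen K α) β ∧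
      (minpoly K⟮α⟯ β).natDegree ∣ (D.aroots L).count α) :
    ∃ g : K[X], g ≠ 0 ∧ D.aroots L = (g.aroots L).map (· ^ n) := by
  induction D using UniqueFactorizationMonoid.induction_on_coprime with
  | h0 => exact absurd rfl hD
  | h1 hx => exact ⟨1, one_ne_zero, by simp [aroots_of_isUnit hx]⟩
  | @hpr p i hp =>
    rcases Nat.eq_zero_or_pos i with rfl | hi
    · exact ⟨1, one_ne_zero, by simp⟩
    obtain ⟨α, hα⟩ := IsAlgClosed.exists_aeval_eq_zero L p hp.irreducible.degree_pos.ne'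
    have hαi : IsIntegral K α := isAlgebraic_iff_isIntegral.1 ⟨p, hp.ne_zero, hα⟩
    have hroots := aroots_eq_aroots_minpoly hp.irreducible hα
    have hpi : (p ^ i).aroots L = i • (minpoly K α).aroots L := by rw [aroots_pow, hroots]
    have hmem : α ∈ (minpoly K α).aroots L :=
      mem_aroots.2 ⟨minpoly.ne_zero hαi, minpoly.aeval _ _⟩
    obtain ⟨β, hβ, hdvd⟩ := h α (by rw [hpi]; exact (Multiset.mem_nsmul_of_ne_zero hi.ne').2 hmem)
    have hcount : ((p ^ i).aroots L).count α = i := by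
      rw [hpi, Multiset.count_nsmul, Multiset.count_eq_one_of_mem _ hmem, mul_one]
      exact nodup_roots (minpoly.irreducible hαi).separable.map
    rw [hcount] at hdvd
    obtain ⟨k, rfl⟩ := hdvd
    have hpow : β ^ n = α := by rw [hβ.pow_eq, AdjoinSimple.algebraMap_gen]
    subst hpow
    have hβi : IsIntegral K β := hαi.of_pow hn
    -- Raising the conjugates of `β` to the `n`-th power covers each conjugate of `α` as often as
    -- the degree of `β` over `K⟮α⟯`; `k` such copies give the multiplicity `i`.
    refine ⟨minpoly K β ^ k, pow_ne_zero _ (minpoly.ne_zero hβi), ?_⟩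
    rw [hpi, aroots_pow, Multiset.map_nsmul, map_pow_aroots_minpoly hβi, mul_comm, mul_smul]
  | @hcp x y hxy ihx ihy =>
    have hx : x ≠ 0 := left_ne_zero_of_mul hD
    have hy : y ≠ 0 := right_ne_zero_of_mul hD
    have hcop : IsCoprime x y := hxy.isCoprime
    rw [aroots_mul hD] at h ⊢
    have hdisj : ∀ α ∈ x.aroots L, α ∉ y.aroots L := by
      intro α h1 h2
      obtain ⟨s, t, hst⟩ := hcop
      have := congrArg (aeval α) hst
      simp [(mem_aroots.1 h1).2, (mem_aroots.1 h2).2] at this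
    obtain ⟨g₁, h₁, e₁⟩ := ihx hx fun α hα => by
      have := h α (Multiset.mem_add.2 (Or.inl hα))
      rwa [Multiset.count_add, Multiset.count_eq_zero_of_notMem (hdisj α hα), add_zero] at this
    obtain ⟨g₂, h₂, e₂⟩ := ihy hy fun α hα => by
      have := h α (Multiset.mem_add.2 (Or.inr hα))
      rwa [Multiset.count_add, Multiset.count_eq_zero_of_notMem (fun h' => hdisj α h' hα),
        zero_add] at this
    exact ⟨g₁ * g₂, mul_ne_zero h₁ h₂, by
      rw [aroots_mul (mul_ne_zero h₁ h₂), Multiset.map_add, e₁, e₂]⟩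

end Norm

/-! ### The multiplicity criterion and its multiplicativity. -/

section Criterion

variable {K L : Type u} [Field K] [CharZero K] [Field L] [Algebra K L] [IsAlgClosed L]
  [DecidableEq L]

theorem exists_aroots_eq_map_pow_iff {n : ℕ} (hn : 0 < n) {D : K[X]} (hD : D ≠ 0) :
    (∃ g : K[X], g ≠ 0 ∧ D.aroots L = (g.aroots L).map (· ^ n)) ↔
      ∀ α ∈ D.aroots L, ∀ β : L, IsMinimalRoot K⟮α⟯ n (AdjoinSimple.gen K α) β →
        (minpoly K⟮α⟯ β).natDegree ∣ (D.aroots L).count α := by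
  constructor
  · rintro ⟨g, hg, hDg⟩ α - β hβ
    -- The minimal degree is taken over `K⟮α⟯`, so `g` is first base changed to that field.
    have := hβ.dvd_count_map_aroots (g := g.map (algebraMap K K⟮α⟯))
      ((Polynomial.map_ne_zero_iff (algebraMap K K⟮α⟯).injective).2 hg)
    rwa [aroots_map, ← hDg, AdjoinSimple.algebraMap_gen] at this
  · intro h
    refine exists_aroots_eq_map_pow hn hD fun α hα => ?_
    obtain ⟨β, hβ⟩ := exists_isMinimalRoot L hn (AdjoinSimple.gen K α)
    exact ⟨β, hβ, h α hα β hβ⟩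

theorem exists_aroots_eq_map_pow_mul_iff {m n : ℕ} (hm : 0 < m) (hn : 0 < n) (hmn : m.Coprime n)
    {D : K[X]} (hD : D ≠ 0) :
    (∃ g : K[X], g ≠ 0 ∧ D.aroots L = (g.aroots L).map (· ^ (m * n))) ↔
      (∃ g : K[X], g ≠ 0 ∧ D.aroots L = (g.aroots L).map (· ^ m)) ∧
        ∃ g : K[X], g ≠ 0 ∧ D.aroots L = (g.aroots L).map (· ^ n) := by
  rw [exists_aroots_eq_map_pow_iff hm hD, exists_aroots_eq_map_pow_iff hn hD,
    exists_aroots_eq_map_pow_iff (Nat.mul_pos hm hn) hD, ← forall₂_and]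
  refine forall₂_congr fun α _ => ?_
  obtain ⟨β, hβ⟩ := exists_isMinimalRoot L hm (AdjoinSimple.gen K α)
  obtain ⟨γ, hγ⟩ := exists_isMinimalRoot L hn (AdjoinSimple.gen K α)
  obtain ⟨δ, hδ⟩ := exists_isMinimalRoot L (Nat.mul_pos hm hn) (AdjoinSimple.gen K α)
  have key : ∀ {k : ℕ} {x : L} (N : ℕ), IsMinimalRoot K⟮α⟯ k (AdjoinSimple.gen K α) x →
      ((∀ y : L, IsMinimalRoot K⟮α⟯ k (AdjoinSimple.gen K α) y → (minpoly K⟮α⟯ y).natDegree ∣ N) ↔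
        (minpoly K⟮α⟯ x).natDegree ∣ N) := fun N hx =>
    ⟨fun h => h _ hx, fun h y hy => (hy.dvd_of_pow_eq _ hx.pow_eq).trans h⟩
  rw [key _ hβ, key _ hγ, key _ hδ, hβ.natDegree_mul_eq hm hn hmn hγ hδ]
  have hcop := Nat.Coprime.coprime_dvd_left hβ.dvd (hmn.coprime_dvd_right hγ.dvd)
  exact ⟨fun h => ⟨(dvd_mul_right _ _).trans h, (dvd_mul_left _ _).trans h⟩,
    fun h => hcop.mul_dvd_of_dvd_of_dvd h.1 h.2⟩

end Criterion

/-! ### Roots of the product of rotated polynomials. -/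

section RotationProduct

theorem prod_range_C_pow_mul_X_sub_C {R : Type*} [CommRing R] [IsDomain R] {n : ℕ} (hn : 0 < n)
    {ζ : R} (hζ : IsPrimitiveRoot ζ n) (b : R) :
    ∏ j ∈ Finset.range n, (C (ζ ^ j) * X - C b) = C ((-1) ^ (n + 1)) * (X ^ n - C (b ^ n)) := by
  classical
  have hζ' : IsPrimitiveRoot (C ζ) n := hζ.map_of_injective C_injective
  have h1 := hζ'.pow_sub_pow_eq_prod_sub_mul (C b) X hn
  have h2 : ∏ z ∈ nthRootsFinset n (1 : R[X]), (C b - z * X) =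
      ∏ j ∈ Finset.range n, (C b - C (ζ ^ j) * X) := by
    have h3 := hζ'.nthRoots_eq (one_pow n)
    rw [nthRootsFinset_def, Finset.prod_eq_multiset_prod, Multiset.toFinset_val,
      Multiset.dedup_eq_self.2 hζ'.nthRoots_one_nodup, h3, Multiset.map_map,
      Finset.prod_eq_multiset_prod]
    simp
  have h4 : ∏ j ∈ Finset.range n, (C (ζ ^ j) * X - C b) =
      (-1) ^ n * ∏ j ∈ Finset.range n, (C b - C (ζ ^ j) * X) := by
    rw [← Finset.card_range n, ← Finset.prod_const, Finset.card_range, ← Finset.prod_mul_distrib]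
    exact Finset.prod_congr rfl fun _ _ => by ring
  rw [h4, ← h2, ← h1]
  simp only [map_pow, map_neg, map_one]
  ring

variable {L : Type*} [Field L] [IsAlgClosed L] {n : ℕ} {ζ : L}

/-- Each linear factor `X - b` of `G` contributes `(-1) ^ (n + 1) * (X ^ n - b ^ n)`, and the
leading coefficient occurs `n` times. -/
theorem prod_range_comp_eq (hn : 0 < n) (hζ : IsPrimitiveRoot ζ n) (G : L[X]) :
    ∏ j ∈ Finset.range n, G.comp (C (ζ ^ j) * X) =
      C (G.leadingCoeff ^ n * ((-1) ^ (n + 1)) ^ G.natDegree) *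
        (((G.roots.map (· ^ n)).map (X - C ·)).prod).comp (X ^ n) := by
  have key : ∀ s : Multiset L,
      ∏ j ∈ Finset.range n, ((s.map (X - C ·)).prod).comp (C (ζ ^ j) * X) =
        C (((-1) ^ (n + 1)) ^ s.card) * (((s.map (· ^ n)).map (X - C ·)).prod).comp (X ^ n) := by
    intro s
    induction s using Multiset.induction_on with
    | empty => simp
    | cons b s ih =>
      simp only [Multiset.map_cons, Multiset.prod_cons, mul_comp, Finset.prod_mul_distrib, ih,
        sub_comp, X_comp, C_comp, prod_range_C_pow_mul_X_sub_C hn hζ, Multiset.card_cons,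
        pow_succ _ s.card, C_mul]
      ring
  conv_lhs => rw [(IsAlgClosed.splits G).eq_prod_roots]
  simp only [mul_comp, C_comp, Finset.prod_mul_distrib, Finset.prod_const, Finset.card_range]
  rw [key, IsAlgClosed.card_roots_eq_natDegree]
  simp only [C_mul, C_pow, mul_assoc]

theorem roots_eq_map_pow_of_comp_eq (hn : 0 < n) (hζ : IsPrimitiveRoot ζ n) {D G : L[X]} {u : L}
    (hu : u ≠ 0) (hG : G ≠ 0)
    (h : D.comp (X ^ n) = C u * ∏ j ∈ Finset.range n, G.comp (C (ζ ^ j) * X)) :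
    D.roots = G.roots.map (· ^ n) := by
  rw [prod_range_comp_eq hn hζ, ← mul_assoc, ← C_mul] at h
  have hD : D = C (u * (G.leadingCoeff ^ n * ((-1) ^ (n + 1)) ^ G.natDegree)) *
      ((G.roots.map (· ^ n)).map (X - C ·)).prod := by
    apply expand_injective hn
    rw [expand_eq_comp_X_pow, expand_eq_comp_X_pow, h, mul_comp, C_comp]
  rw [hD, roots_C_mul, roots_multiset_prod_X_sub_C]
  exact mul_ne_zero hu (mul_ne_zero (pow_ne_zero _ (leadingCoeff_ne_zero.2 hG))
    (pow_ne_zero _ (pow_ne_zero _ (by simp))))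

theorem comp_eq_of_roots_eq_map_pow (hn : 0 < n) (hζ : IsPrimitiveRoot ζ n) {D G : L[X]}
    (h : D.roots = G.roots.map (· ^ n)) :
    C (G.leadingCoeff ^ n * ((-1) ^ (n + 1)) ^ G.natDegree) * D.comp (X ^ n) =
      C D.leadingCoeff * ∏ j ∈ Finset.range n, G.comp (C (ζ ^ j) * X) := by
  rw [prod_range_comp_eq hn hζ, ← h]
  conv_lhs => rw [(IsAlgClosed.splits D).eq_prod_roots]
  rw [mul_comp, C_comp]
  ring

end RotationProduct

/-! ### The constant is a sign. -/

section Integrality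

/-- A generator of `ker φ` would divide every coefficient of `f`, hence be a unit killed by `φ`. -/
theorem Polynomial.IsPrimitive.map_intRingHom_ne_zero {k : Type*} [CommRing k]
    [Nontrivial k] (φ : ℤ →+* k) {f : ℤ[X]} (hf : f.IsPrimitive) : f.map φ ≠ 0 := by
  intro h
  obtain ⟨d, hd⟩ := (IsPrincipalIdealRing.principal (RingHom.ker φ)).principal
  have h1 : C d ∣ f := by
    rw [C_dvd_iff_dvd_coeff]
    intro i
    rw [← Ideal.mem_span_singleton]
    have : f.coeff i ∈ RingHom.ker φ := by rw [RingHom.mem_ker, ← coeff_map, h, coeff_zero]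
    rw [hd] at this
    exact this
  have h2 : d ∈ RingHom.ker φ := by rw [hd]; exact Submodule.mem_span_singleton_self d
  exact ((hf d h1).map φ).ne_zero h2

theorem comp_X_pow_ne_zero {k : Type*} [CommRing k] [IsDomain k] {f : k[X]} (hf : f ≠ 0) {n : ℕ}
    (hn : 0 < n) : f.comp (X ^ n) ≠ 0 := by
  rw [← expand_eq_comp_X_pow]
  exact (expand_ne_zero hn).2 hf

theorem comp_C_mul_X_ne_zero {k : Type*} [CommRing k] [IsDomain k] {f : k[X]} (hf : f ≠ 0) {u : k}
    (hu : u ≠ 0) : f.comp (C u * X) ≠ 0 := by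
  rw [Ne, comp_eq_zero_iff, not_or]
  refine ⟨hf, fun h => hu ?_⟩
  have := congrArg (coeff · 1) h.2
  simpa using this

/-- A maximal ideal of the algebraic integers above `p` gives a reduction mod `p` that is defined on
roots of unity. -/
theorem exists_ringHom_integralClosure {p : ℕ} (hp : p.Prime) :
    ∃ (k : Type) (_ : Field k) (_ : integralClosure ℤ ℂ →+* k), CharP k p := by
  have hpi : Prime (p : ℤ) := Nat.prime_iff_prime_int.1 hp
  have hmax : (Ideal.span {(p : ℤ)}).IsMaximal :=
    PrincipalIdealRing.isMaximal_of_irreducible hpi.irreducible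
  obtain ⟨Q, hQ, hcomap⟩ := Ideal.exists_ideal_over_maximal_of_isIntegral
    (S := integralClosure ℤ ℂ) (Ideal.span {(p : ℤ)}) (by
      rw [(RingHom.injective_iff_ker_eq_bot _).1
        (FaithfulSMul.algebraMap_injective ℤ (integralClosure ℤ ℂ))]
      exact bot_le)
  refine ⟨_, Ideal.Quotient.field Q, Ideal.Quotient.mk Q, ⟨fun x => ?_⟩⟩
  rw [← map_natCast (Ideal.Quotient.mk Q), Ideal.Quotient.eq_zero_iff_mem]
  have : ((x : integralClosure ℤ ℂ)) = algebraMap ℤ (integralClosure ℤ ℂ) x := by simp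
  rw [this, ← Ideal.mem_comap, hcomap, Ideal.mem_span_singleton, Int.natCast_dvd_natCast]

/-- As in Gauss's lemma: modulo a prime above `p` both polynomial factors stay nonzero, so `a` and
`b` vanish together. -/
theorem prime_dvd_iff_of_comp_eq {n : ℕ} (hn : 0 < n) {ζ : ℂ} (hζ : IsPrimitiveRoot ζ n)
    {D g : ℤ[X]} (hD : D.IsPrimitive) (hg : g.IsPrimitive) {a b : ℤ}
    (h : C (b : ℂ) * (D.map (Int.castRingHom ℂ)).comp (X ^ n) =
      C (a : ℂ) * ∏ j ∈ Finset.range n, (g.map (Int.castRingHom ℂ)).comp (C (ζ ^ j) * X))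
    {p : ℕ} (hp : p.Prime) : (p : ℤ) ∣ a ↔ (p : ℤ) ∣ b := by
  obtain ⟨k, _, φ, _⟩ := exists_ringHom_integralClosure hp
  let O := integralClosure ℤ ℂ
  let z : O := ⟨ζ, IsIntegral.of_pow hn (hζ.pow_eq_one ▸ isIntegral_one)⟩
  have hO : C (b : O) * (D.map (Int.castRingHom O)).comp (X ^ n) =
      C (a : O) * ∏ j ∈ Finset.range n, (g.map (Int.castRingHom O)).comp (C (z ^ j) * X) := by
    apply map_injective (algebraMap O ℂ) (FaithfulSMul.algebraMap_injective O ℂ)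
    have e : (algebraMap O ℂ).comp (Int.castRingHom O) = Int.castRingHom ℂ := RingHom.ext_int _ _
    have ez : algebraMap O ℂ z = ζ := rfl
    simpa [Polynomial.map_mul, Polynomial.map_prod, Polynomial.map_comp, Polynomial.map_map, e,
      Polynomial.map_pow, ez] using h
  have hk := congrArg (Polynomial.map φ) hO
  have e : φ.comp (Int.castRingHom O) = Int.castRingHom k := RingHom.ext_int _ _
  have hz : φ z ≠ 0 := by
    have : z ^ n = 1 := Subtype.ext hζ.pow_eq_one
    intro h0
    have h1 := congrArg φ this
    rw [map_pow, h0, zero_pow hn.ne', map_one] at h1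
    exact zero_ne_one h1
  simp only [Polynomial.map_mul, Polynomial.map_prod, Polynomial.map_comp, Polynomial.map_map, e,
      Polynomial.map_pow, map_C, map_X, map_intCast φ, map_pow φ] at hk
  have h1 := comp_X_pow_ne_zero (hD.map_intRingHom_ne_zero (Int.castRingHom k)) hn
  have h2 : ∏ j ∈ Finset.range n, (g.map (Int.castRingHom k)).comp (C (φ z ^ j) * X) ≠ 0 :=
    Finset.prod_ne_zero_iff.2 fun j _ => comp_C_mul_X_ne_zero
      (hg.map_intRingHom_ne_zero (Int.castRingHom k)) (pow_ne_zero _ hz)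
  rw [← CharP.intCast_eq_zero_iff k p, ← CharP.intCast_eq_zero_iff k p]
  constructor
  · intro ha
    rw [ha, C_0, zero_mul] at hk
    exact C_eq_zero.1 ((mul_eq_zero.1 hk).resolve_right h1)
  · intro hb
    rw [hb, C_0, zero_mul] at hk
    exact C_eq_zero.1 ((mul_eq_zero.1 hk.symm).resolve_right h2)

theorem isHartley_of_comp_eq {n : ℕ} (hn : 0 < n) {D g : ℤ[X]} (hD : D.IsPrimitive)
    (hg : g.IsPrimitive) {a b : ℤ} (ha : a ≠ 0)
    (h : C (b : ℂ) * (D.map (Int.castRingHom ℂ)).comp (X ^ n) =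
      C (a : ℂ) * ∏ j ∈ Finset.range n, (g.map (Int.castRingHom ℂ)).comp
        (C (Complex.exp (2 * Real.pi * Complex.I / n) ^ j) * X)) :
    IsHartley n D := by
  have hζ := Complex.isPrimitiveRoot_exp n hn.ne'
  -- Once `a` and `b` are coprime, a prime dividing one would divide both, so both are `±1`.
  obtain ⟨d, a, b, hd, hab, rfl, rfl⟩ : ∃ d a' b' : ℤ, d ≠ 0 ∧ IsCoprime a' b' ∧
      a = d * a' ∧ b = d * b' := by
    have hpos : 0 < Int.gcd a b := Int.gcd_pos_of_ne_zero_left b ha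
    obtain ⟨a', b', h1, h2, h3⟩ := Int.exists_gcd_one hpos
    exact ⟨Int.gcd a b, a', b', by exact_mod_cast hpos.ne', Int.isCoprime_iff_gcd_eq_one.2 h1,
      by rwa [mul_comm], by rwa [mul_comm]⟩
  replace h : C (b : ℂ) * (D.map (Int.castRingHom ℂ)).comp (X ^ n) =
      C (a : ℂ) * ∏ j ∈ Finset.range n, (g.map (Int.castRingHom ℂ)).comp
        (C (Complex.exp (2 * Real.pi * Complex.I / n) ^ j) * X) := by
    have hd' : C (d : ℂ) ≠ 0 := by simpa using hd
    apply mul_left_cancel₀ hd'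
    rw [← mul_assoc, ← mul_assoc, ← C_mul, ← C_mul]
    exact_mod_cast h
  have hnot : ∀ p : ℕ, p.Prime → ¬ (p : ℤ) ∣ a ∧ ¬ (p : ℤ) ∣ b := by
    intro p hp
    have hiff := prime_dvd_iff_of_comp_eq hn hζ hD hg h hp
    have : ¬ ((p : ℤ) ∣ a ∧ (p : ℤ) ∣ b) := fun hpab =>
      (Nat.prime_iff_prime_int.1 hp).not_isUnit (hab.isUnit_of_dvd' hpab.1 hpab.2)
    tauto
  have hunit : ∀ c : ℤ, (∀ p : ℕ, p.Prime → ¬ (p : ℤ) ∣ c) → c = 1 ∨ c = -1 := by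
    intro c hc
    have : c.natAbs = 1 := Nat.eq_one_iff_not_exists_prime_dvd.2
      fun p hp hpc => hc p hp (Int.natCast_dvd.2 hpc)
    omega
  refine ⟨g, ?_⟩
  rcases hunit a fun p hp => (hnot p hp).1 with rfl | rfl <;>
  rcases hunit b fun p hp => (hnot p hp).2 with rfl | rfl
  · left; simpa using h
  · right; simpa [neg_eq_iff_eq_neg] using h
  · right; simpa using h
  · left; simpa using h

theorem exists_isPrimitive_roots_eq {g : ℚ[X]} (hg : g ≠ 0) :
    ∃ g₀ : ℤ[X], g₀.IsPrimitive ∧ (g₀.map (Int.castRingHom ℂ)).roots = g.aroots ℂ := by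
  obtain ⟨b, hb, hgb⟩ := IsLocalization.integerNormalization_spec (nonZeroDivisors ℤ) g
  set f := IsLocalization.integerNormalization (nonZeroDivisors ℤ) g
  have hb0 : b ≠ 0 := nonZeroDivisors.ne_zero hb
  have hf : f ≠ 0 := by
    intro hf
    rw [hf, Polynomial.map_zero] at hgb
    exact (smul_ne_zero hb0 hg) hgb.symm
  refine ⟨f.primPart, f.isPrimitive_primPart, ?_⟩
  have h1 : f.map (Int.castRingHom ℂ) =
      C (f.content : ℂ) * f.primPart.map (Int.castRingHom ℂ) := by
    conv_lhs => rw [f.eq_C_content_mul_primPart]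
    simp
  have h2 : f.map (Int.castRingHom ℂ) = C (b : ℂ) * g.map (algebraMap ℚ ℂ) := by
    have := congrArg (Polynomial.map (algebraMap ℚ ℂ)) hgb
    rw [Polynomial.map_map] at this
    rw [RingHom.ext_int (Int.castRingHom ℂ) ((algebraMap ℚ ℂ).comp (algebraMap ℤ ℚ)), this,
      ← Int.cast_smul_eq_zsmul ℚ, smul_eq_C_mul]
    simp
  rw [aroots_def, ← roots_C_mul (a := (f.content : ℂ)), ← h1, h2, roots_C_mul]
  · simpa using hb0
  · simpa [content_eq_zero_iff] using hf

theorem isHartley_iff_exists_aroots_eq {n : ℕ} (hn : 0 < n) {D : ℤ[X]} (hD : D.IsPrimitive) :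
    IsHartley n D ↔ ∃ g : ℚ[X], g ≠ 0 ∧
      (D.map (Int.castRingHom ℚ)).aroots ℂ = (g.aroots ℂ).map (· ^ n) := by
  have hζ := Complex.isPrimitiveRoot_exp n hn.ne'
  have hmap : ∀ f : ℤ[X],
      (f.map (Int.castRingHom ℚ)).aroots ℂ = (f.map (Int.castRingHom ℂ)).roots := by
    intro f
    rw [aroots_def, Polynomial.map_map]
    congr 2
  have hne : ∀ {f : ℤ[X]}, f ≠ 0 → f.map (Int.castRingHom ℂ) ≠ 0 := fun hf =>
    (Polynomial.map_ne_zero_iff (RingHom.injective_int _)).2 hf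
  constructor
  · rintro ⟨g, hg⟩
    have hg0 : g ≠ 0 := by
      rintro rfl
      have := comp_X_pow_ne_zero (hne hD.ne_zero) hn
      simp [hn.ne', this] at hg
    refine ⟨g.map (Int.castRingHom ℚ),
      (Polynomial.map_ne_zero_iff (RingHom.injective_int _)).2 hg0, ?_⟩
    rw [hmap, hmap]
    rcases hg with hg | hg
    · exact roots_eq_map_pow_of_comp_eq hn hζ one_ne_zero (hne hg0) (by rw [hg, C_1, one_mul])
    · exact roots_eq_map_pow_of_comp_eq hn hζ (neg_ne_zero.2 one_ne_zero) (hne hg0)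
        (by rw [hg, C_neg, C_1, neg_one_mul])
  · rintro ⟨g, hg, hDg⟩
    obtain ⟨g₀, hg₀, hroots⟩ := exists_isPrimitive_roots_eq hg
    rw [hmap, ← hroots] at hDg
    have h := comp_eq_of_roots_eq_map_pow hn hζ hDg
    refine isHartley_of_comp_eq hn hD hg₀ (a := D.leadingCoeff)
      (b := g₀.leadingCoeff ^ n * ((-1) ^ (n + 1)) ^ g₀.natDegree)
      (leadingCoeff_ne_zero.2 hD.ne_zero) ?_
    have hinj : Function.Injective (Int.castRingHom ℂ) := RingHom.injective_int _
    rw [leadingCoeff_map_of_injective hinj, leadingCoeff_map_of_injective hinj,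
      natDegree_map_eq_of_injective hinj] at h
    simpa using h

end Integrality

theorem theorem1p6 (m n : ℕ) (hm : 0 < m) (hn : 0 < n) (hmn : Nat.Coprime m n)
    (Δ : ℤ[X]) (hΔ : Δ.IsPrimitive) :
    IsHartley (m * n) Δ ↔ IsHartley m Δ ∧ IsHartley n Δ := by
  classical
  rw [isHartley_iff_exists_aroots_eq (Nat.mul_pos hm hn) hΔ, isHartley_iff_exists_aroots_eq hm hΔ,
    isHartley_iff_exists_aroots_eq hn hΔ]
  exact exists_aroots_eq_map_pow_mul_iff hm hn hmn
    ((Polynomial.map_ne_zero_iff (RingHom.injective_int _)).2 hΔ.ne_zero)
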